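/- Let $R$ be a commutative ring, let $H$ be a Hopf algebra over $R$, with comultiplication $\Delta(h)=\sum_{(h)} h_1\otimes h_2$ and counit $\varepsilon$, that is finitely generated and projective as an $R$-module, and let $A$ be a left $H$-module algebra: an associative unital $R$-algebra with an $R$-linear left $H$-action such that $h\cdot 1_A=\varepsilon(h)1_A$ and $h\cdot(ab)=\sum_{(h)}(h_1\cdot a)(h_2\cdot b)$ for all $h\in H$ and $a,b\in A$. The smash product $A\# H$ is the $R$-module $A\otimes_R H$ with the multiplication $(a\# h)(b\# g)=\sum_{(h)}a(h_1\cdot b)\# h_2g$. For a ring $S$, let $E(S)$ be the injective hull of the left $S$-module $S$. The maximal left ring of quotients $Q_{\max}(S)$ is the biendomorphism ring of $E(S)$, that is, the ring of endomorphisms of $E(S)$ as a left module over $\operatorname{End}_S(E(S))$; there is a canonical ring homomorphism $S\to Q_{\max}(S)$, which sends $s$ to the multiplication by $s$ on $E(S)$. The ring $S$ is left non-singular if $0$ is the only element of $S$ whose left annihilator is an essential left ideal of $S$. Assume that there is a left or right integral $t\in H$ (that is, $ht=\varepsilon(h)t$ for all $h\in H$, or $th=\varepsilon(h)t$ for all $h\in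 H$) such that $\varepsilon(t)1_A$ is invertible in $A$. Assume that the $H$-action extends to $Q_{\max}(A)$, i.e. $Q_{\max}(A)$ is equipped with the structure of a left $H$-module algebra over $R$ (where $R$ acts on $Q_{\max}(A)$ through $R\to A\to Q_{\max}(A)$) for which the canonical map $A\to Q_{\max}(A)$ is $H$-linear. If $A$ is left non-singular, then $A\# H$ is left non-singular, and there is a ring isomorphism $Q_{\max}(A\# H)\cong Q_{\max}(A)\# H$ under which the canonical map $A\# H\to Q_{\max}(A\# H)$ corresponds to the map $A\# H\to Q_{\max}(A)\# H$ induced by $A\to Q_{\max}(A)$. -/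

import Mathlib

open scoped TensorProduct

/-! ### Essential submodules, injective hulls, left non-singular rings -/

section InjectiveHull

universe u v

/-- A submodule `N` of `M` is essential if it meets every non-zero submodule non-trivially. -/
def IsEssentialSubmodule {S : Type u} {M : Type v} [Ring S] [AddCommGroup M] [Module S M]
    (N : Submodule S M) : Prop :=
  ∀ L : Submodule S M, N ⊓ L = ⊥ → L = ⊥

/-- `f : M → E` exhibits the left module `E` as an injective hull of `M`: `E` is injective, and
`f` is a monomorphism with essential image. -/
structure IsInjectiveHull {S : Type u} {M E : Type v} [Ring S] [AddCommGroup M] [Module S M]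
    [AddCommGroup E] [Module S E] (f : M →ₗ[S] E) : Prop where
  moduleInjective : Module.Injective S E
  injective : Function.Injective f
  essential : IsEssentialSubmodule (LinearMap.range f)

/-- Every module has an injective hull. -/
theorem exists_isInjectiveHull (S : Type u) (M : Type v) [Ring S] [Small.{v} S]
    [AddCommGroup M] [Module S M] :
    ∃ (E : Type v) (_ : AddCommGroup E) (_ : Module S E) (f : M →ₗ[S] E), IsInjectiveHull f := by
  obtain ⟨J, iJ1, iJ2, hJ, i, hi⟩ : ∃ (J : Type v) (_ : AddCommGroup J) (_ : Module S J),
      Module.Injective S J ∧ ∃ i : M →ₗ[S] J, Function.Injective i := by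
    obtain ⟨⟨J, hJ, f, hf⟩⟩ :=
      CategoryTheory.EnoughInjectives.presentation (ModuleCat.of S M)
    exact ⟨J, inferInstance, inferInstance,
      Module.injective_module_of_injective_object (R := S) (M := J) (inj := hJ), f.hom,
      (ModuleCat.mono_iff_injective f).1 hf⟩
  let P : Set (Submodule S J) := {E | LinearMap.range i ≤ E ∧
    ∀ L : Submodule S J, L ≤ E → LinearMap.range i ⊓ L = ⊥ → L = ⊥}
  have hP0 : LinearMap.range i ∈ P :=
    ⟨le_rfl, fun L hL h => by rwa [inf_eq_right.2 hL] at h⟩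
  obtain ⟨E, hE0, hE⟩ := zorn_le_nonempty₀ P (by
    intro c hc hchain y hy
    refine ⟨sSup c, ⟨(hc hy).1.trans (le_sSup hy), ?_⟩, fun z hz => le_sSup hz⟩
    intro L hL h
    rw [eq_bot_iff]
    intro x hx
    obtain ⟨z, hz, hxz⟩ := (Submodule.mem_sSup_of_directed ⟨y, hy⟩ hchain.directedOn).1 (hL hx)
    have := (hc hz).2 (L ⊓ z) inf_le_right (by
      rw [eq_bot_iff, ← h]
      exact inf_le_inf_left _ inf_le_left)
    rw [← this]
    exact ⟨hx, hxz⟩) _ hP0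
  obtain ⟨C, -, hC⟩ := zorn_le_nonempty₀ {C : Submodule S J | C ⊓ E = ⊥} (by
    intro c hc hchain y hy
    refine ⟨sSup c, ?_, fun z hz => le_sSup hz⟩
    change sSup c ⊓ E = ⊥
    rw [eq_bot_iff]
    rintro x ⟨hx, hxE⟩
    obtain ⟨z, hz, hxz⟩ := (Submodule.mem_sSup_of_directed ⟨y, hy⟩ hchain.directedOn).1 hx
    have h1 : z ⊓ E = ⊥ := hc hz
    rw [← h1]
    exact ⟨hxz, hxE⟩) ⊥ (by simp)
  have hCE : C ⊓ E = ⊥ := hC.prop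
  have hEP := hE.prop
  obtain ⟨h, hh⟩ := hJ.out (C.mkQ ∘ₗ E.subtype) (by
    rw [← LinearMap.ker_eq_bot, eq_bot_iff]
    intro x hx
    have h1 : (x : J) ∈ C := by simpa using hx
    have h2 : (x : J) ∈ C ⊓ E := ⟨h1, x.2⟩
    rw [hCE] at h2
    simpa using h2) E.subtype
  have hh' : ∀ x ∈ E, h (C.mkQ x) = x := fun x hx => hh ⟨x, hx⟩
  have hle : E ≤ LinearMap.range h := fun x hx => ⟨C.mkQ x, hh' x hx⟩
  have hrange : LinearMap.range h ∈ P := by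
    refine ⟨hEP.1.trans hle, fun L hL hiL => ?_⟩
    have hEL : E ⊓ L = ⊥ := hEP.2 _ inf_le_left (by
      rw [eq_bot_iff, ← hiL]
      exact inf_le_inf_left _ inf_le_right)
    have hD : Submodule.comap (h ∘ₗ C.mkQ) L ≤ C := by
      refine hC.le_of_ge ?_ ?_
      · change _ ⊓ E = ⊥
        rw [eq_bot_iff, ← hEL]
        rintro x ⟨hx, hxE⟩
        refine ⟨hxE, ?_⟩
        have : h (C.mkQ x) ∈ L := hx
        rwa [hh' x hxE] at this
      · intro x hx
        have : C.mkQ x = 0 := by simpa using hx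
        simp only [Submodule.mem_comap, LinearMap.comp_apply, this, map_zero, zero_mem]
    rw [eq_bot_iff]
    intro x hx
    obtain ⟨y, rfl⟩ := hL hx
    obtain ⟨y, rfl⟩ := C.mkQ_surjective y
    have h1 : y ∈ C := hD hx
    have : C.mkQ y = 0 := by simpa using h1
    simp [this]
  have hrE : ∀ y, h y ∈ E := fun y => hE.le_of_ge hrange hle ⟨y, rfl⟩
  refine ⟨E, inferInstance, inferInstance, i.codRestrict E fun x => hEP.1 ⟨x, rfl⟩,
    ⟨⟨fun X Y _ _ _ _ f hf g => ?_⟩, ?_, ?_⟩⟩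
  · obtain ⟨k, hk⟩ := hJ.out f hf (E.subtype ∘ₗ g)
    refine ⟨(h ∘ₗ C.mkQ ∘ₗ k).codRestrict E fun x => hrE _, fun x => Subtype.ext ?_⟩
    have : k (f x) = g x := hk x
    simp only [LinearMap.codRestrict_apply, LinearMap.comp_apply, this]
    exact hh' _ (g x).2
  · intro x y hxy
    exact hi (congrArg Subtype.val hxy)
  · intro L hL
    have := hEP.2 (L.map E.subtype) (Submodule.map_subtype_le _ _) (by
      rw [eq_bot_iff]
      rintro _ ⟨⟨m, rfl⟩, ⟨y, hy, hym⟩⟩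
      have h1 : y ∈ LinearMap.range (i.codRestrict E fun x => hEP.1 ⟨x, rfl⟩) ⊓ L :=
        ⟨⟨m, Subtype.ext hym.symm⟩, hy⟩
      rw [hL] at h1
      have h2 : y = 0 := by simpa using h1
      rw [← hym, h2]
      simp)
    exact Submodule.map_injective_of_injective E.injective_subtype (by rw [this, Submodule.map_bot])

variable (S : Type u) [Ring S]

/-- The injective hull `E(S)` of the left regular module of a ring `S`. -/
def InjHull : Type u := (exists_isInjectiveHull S S).choose

noncomputable instance InjHull.instAddCommGroup : AddCommGroup (InjHull S) :=
  (exists_isInjectiveHull S S).choose_spec.choose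

noncomputable instance InjHull.instModule : Module S (InjHull S) :=
  (exists_isInjectiveHull S S).choose_spec.choose_spec.choose

/-- The embedding of `S` into its injective hull. -/
noncomputable def InjHull.of : S →ₗ[S] InjHull S :=
  (exists_isInjectiveHull S S).choose_spec.choose_spec.choose_spec.choose

theorem InjHull.isInjectiveHull : IsInjectiveHull (InjHull.of S) :=
  (exists_isInjectiveHull S S).choose_spec.choose_spec.choose_spec.choose_spec

/-- The maximal left ring of quotients of `S`: the biendomorphism ring of the injective hull of
the left module `S`, i.e. the ring of endomorphisms of `E(S)` as a left module over
`End_S(E(S))`. -/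
abbrev Qmax : Type u := Module.End (Module.End S (InjHull S)) (InjHull S)

/-- The canonical ring homomorphism `S → Q_max(S)`, sending `s` to the multiplication by `s`
on `E(S)`. -/
noncomputable def Qmax.of : S →+* Qmax S :=
  Module.toModuleEnd (Module.End S (InjHull S)) (InjHull S)

/-- `S` is left non-singular: its left singular ideal vanishes, i.e. an element whose left
annihilator `{x | x * s = 0}` is an essential left ideal is zero. -/
def IsLeftNonsingular : Prop :=
  ∀ s : S, IsEssentialSubmodule (LinearMap.ker (LinearMap.toSpanSingleton S S s)) → s = 0

/-- If `A` is an algebra over a commutative ring `R`, then so is `Q_max(A)`, through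
`R → A → Q_max(A)`. -/
noncomputable instance Qmax.instAlgebra (R : Type v) (A : Type u) [CommRing R] [Ring A]
    [Algebra R A] : Algebra R (Qmax A) :=
  ((Qmax.of A).comp (algebraMap R A)).toAlgebra' fun r φ => by
    let m : Module.End A (InjHull A) :=
      { toFun := fun x => algebraMap R A r • x
        map_add' := fun x y => smul_add _ x y
        map_smul' := fun a x => by
          simp only [RingHom.id_apply, smul_smul, Algebra.commutes r a] }
    refine LinearMap.ext fun x => ?_
    exact (φ.map_smul m x).symm

theorem Qmax.algebraMap_eq (R : Type v) (A : Type u) [CommRing R] [Ring A] [Algebra R A] (r : R) :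
    algebraMap R (Qmax A) r = Qmax.of A (algebraMap R A r) := rfl

/-- The canonical map `A → Q_max(A)` as a homomorphism of `R`-algebras. -/
noncomputable def Qmax.ofAlgHom (R : Type v) (A : Type u) [CommRing R] [Ring A] [Algebra R A] :
    A →ₐ[R] Qmax A :=
  { Qmax.of A with commutes' := fun _ => rfl }

end InjectiveHull

/-! ### Module algebras, smash products, integrals -/

section Hopf

open Coalgebra

universe u v w

/-- The structure of a left `H`-module algebra on the `R`-algebra `A`: an `R`-linear left action
of `H` on `A` with `h · 1 = ε(h) 1` and `h · (a b) = ∑ (h₁ · a) (h₂ · b)`. -/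
structure ModuleAlgebraStr (R : Type u) (H : Type v) (A : Type w) [CommRing R] [Ring H]
    [HopfAlgebra R H] [Ring A] [Algebra R A] where
  /-- `act h a` is `h · a`. -/
  act : H →ₐ[R] Module.End R A
  act_one : ∀ h : H, act h 1 = algebraMap R A (counit h)
  act_mul : ∀ (h : H) (a b : A), act h (a * b) =
    LinearMap.mul' R A
      (TensorProduct.map (act.toLinearMap.flip a) (act.toLinearMap.flip b) (comul (R := R) h))

variable {R : Type u} {H : Type v} {A : Type w} [CommRing R] [Ring H] [HopfAlgebra R H]
  [Ring A] [Algebra R A]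

theorem ModuleAlgebraStr.act_mul_repr (α : ModuleAlgebraStr R H A) {ι : Type*} {h : H}
    (r : Repr R h ι) (a b : A) :
    α.act h (a * b) = ∑ i ∈ r.index, α.act (r.left i) a * α.act (r.right i) b := by
  rw [α.act_mul, ← r.eq]
  simp

/-- The smash product `A # H`: the `R`-module `A ⊗[R] H`, with the multiplication
`(a # h) (b # g) = ∑ a (h₁ · b) # h₂ g` (see `SmashProduct.tmul_mul_tmul`). -/
def SmashProduct (_α : ModuleAlgebraStr R H A) : Type (max w v) := A ⊗[R] H

namespace SmashProduct

variable (α : ModuleAlgebraStr R H A)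

noncomputable instance : AddCommGroup (SmashProduct α) :=
  inferInstanceAs (AddCommGroup (A ⊗[R] H))

noncomputable instance : Module R (SmashProduct α) :=
  inferInstanceAs (Module R (A ⊗[R] H))

/-- The element `a # h`. -/
def tmul (a : A) (h : H) : SmashProduct α := a ⊗ₜ[R] h

/-- The action of `H` on `A ⊗[R] H` given by `h · (b ⊗ g) = ∑ (h₁ · b) ⊗ h₂ g`. -/
noncomputable def diagAct : H →ₐ[R] Module.End R (A ⊗[R] H) :=
  ((Module.endTensorEndAlgHom (R := R) (S := R) (A := R) (M := A) (N := H)).comp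
    (Algebra.TensorProduct.map α.act (Algebra.lmul R H))).comp (Bialgebra.comulAlgHom R H)

theorem diagAct_tmul {ι : Type*} {h : H} (r : Repr R h ι) (b : A) (g : H) :
    diagAct α h (b ⊗ₜ g) = ∑ i ∈ r.index, α.act (r.left i) b ⊗ₜ[R] (r.right i * g) := by
  simp only [diagAct, AlgHom.comp_apply, Bialgebra.comulAlgHom_apply]
  rw [← r.eq]
  simp [Module.endTensorEndAlgHom_apply]

/-- Left multiplication by elements of `A` on `A ⊗[R] H`. -/
noncomputable def leftAct : A →ₐ[R] Module.End R (A ⊗[R] H) :=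
  (Module.endTensorEndAlgHom (R := R) (S := R) (A := R) (M := A) (N := H)).comp
    ((Algebra.TensorProduct.includeLeft).comp (Algebra.lmul R A))

theorem leftAct_tmul (a b : A) (g : H) :
    leftAct (R := R) (H := H) a (b ⊗ₜ g) = (a * b) ⊗ₜ g := by
  simp [leftAct, Module.endTensorEndAlgHom_apply]

/-- `(a ⊗ h) ↦ (left multiplication by a) ∘ (diagonal action of h)`. -/
noncomputable def mulAux : A ⊗[R] H →ₗ[R] Module.End R (A ⊗[R] H) :=
  LinearMap.mul' R _ ∘ₗ
    TensorProduct.map (leftAct (R := R) (H := H)).toLinearMap (diagAct α).toLinearMap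

theorem mulAux_tmul (a : A) (h : H) :
    mulAux α (a ⊗ₜ h) = leftAct (R := R) (H := H) a * diagAct α h := by
  simp [mulAux]

theorem mulAux_tmul_tmul {ι : Type*} {h : H} (r : Repr R h ι) (a b : A) (g : H) :
    mulAux α (a ⊗ₜ h) (b ⊗ₜ g) =
      ∑ i ∈ r.index, (a * α.act (r.left i) b) ⊗ₜ[R] (r.right i * g) := by
  rw [mulAux_tmul, Module.End.mul_apply, diagAct_tmul α r, map_sum]
  simp only [leftAct_tmul]

theorem diagAct_mul_leftAct {ι : Type*} {h : H} (r : Repr R h ι) (b : A) :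
    diagAct α h * leftAct (R := R) (H := H) b =
      ∑ i ∈ r.index, leftAct (R := R) (H := H) (α.act (r.left i) b) * diagAct α (r.right i) := by
  refine TensorProduct.ext' fun c k => ?_
  simp only [Module.End.mul_apply, leftAct_tmul, LinearMap.sum_apply, diagAct_tmul α r]
  simp only [diagAct_tmul α (ℛ R _), map_sum, leftAct_tmul, α.act_mul_repr (ℛ R _),
    TensorProduct.sum_tmul]
  let F : H ⊗[R] (H ⊗[R] H) →ₗ[R] A ⊗[R] H :=
    TensorProduct.map (LinearMap.mul' R A) LinearMap.id ∘ₗ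
    (TensorProduct.assoc R A A H).symm.toLinearMap ∘ₗ
    TensorProduct.map (α.act.toLinearMap.flip b)
      (TensorProduct.map (α.act.toLinearMap.flip c) (LinearMap.mulRight R k))
  have key := congrArg F (sum_tmul_tmul_eq r (fun i => ℛ R (r.left i)) (fun i => ℛ R (r.right i)))
  simpa [F] using key

theorem mulAux_mulAux (x y : A ⊗[R] H) :
    mulAux α (mulAux α x y) = mulAux α x * mulAux α y := by
  induction x using TensorProduct.induction_on with
  | zero => simp
  | add x₁ x₂ h₁ h₂ => simp only [map_add, LinearMap.add_apply, h₁, h₂, add_mul]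
  | tmul a h =>
    induction y using TensorProduct.induction_on with
    | zero => simp
    | add y₁ y₂ h₁ h₂ => simp only [map_add, h₁, h₂, mul_add]
    | tmul b g =>
      rw [mulAux_tmul_tmul α (ℛ R h), map_sum]
      simp only [mulAux_tmul, map_mul]
      rw [mul_assoc, ← mul_assoc (diagAct α h), diagAct_mul_leftAct α (ℛ R h), Finset.sum_mul,
        Finset.mul_sum]
      simp only [mul_assoc]

theorem mulAux_one : mulAux α (1 ⊗ₜ 1) = 1 := by
  rw [mulAux_tmul, map_one, map_one, mul_one]

theorem mulAux_apply_one (x : A ⊗[R] H) : mulAux α x (1 ⊗ₜ 1) = x := by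
  induction x using TensorProduct.induction_on with
  | zero => simp
  | add x₁ x₂ h₁ h₂ => simp only [map_add, LinearMap.add_apply, h₁, h₂]
  | tmul a h =>
    rw [mulAux_tmul_tmul α (ℛ R h)]
    simp only [α.act_one, mul_one, Algebra.algebraMap_eq_smul_one, mul_smul_comm,
      TensorProduct.smul_tmul, ← TensorProduct.tmul_sum]
    rw [sum_counit_smul]

noncomputable instance : Ring (SmashProduct α) :=
  { (inferInstance : AddCommGroup (SmashProduct α)) with
    mul := fun x y => mulAux α x y
    one := tmul α 1 1
    left_distrib := fun x y z => map_add (mulAux α x) y z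
    right_distrib := fun x y z => LinearMap.congr_fun (map_add (mulAux α) x y) z
    zero_mul := fun x => LinearMap.congr_fun (map_zero (mulAux α)) x
    mul_zero := fun x => map_zero (mulAux α x)
    mul_assoc := fun x y z => LinearMap.congr_fun (mulAux_mulAux α x y) z
    one_mul := fun x => LinearMap.congr_fun (mulAux_one α) x
    mul_one := fun x => mulAux_apply_one α x }

theorem tmul_mul_tmul {ι : Type*} {h : H} (r : Repr R h ι) (a b : A) (g : H) :
    tmul α a h * tmul α b g =
      ∑ i ∈ r.index, tmul α (a * α.act (r.left i) b) (r.right i * g) :=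
  mulAux_tmul_tmul α r a b g

theorem one_def : (1 : SmashProduct α) = tmul α 1 1 := rfl

/-- The map `f # id : A # H → B # H`, `a # h ↦ f(a) # h`, induced by a homomorphism `f : A → B`
of `R`-algebras. -/
noncomputable def map {B : Type*} [Ring B] [Algebra R B] (α : ModuleAlgebraStr R H A)
    (β : ModuleAlgebraStr R H B) (f : A →ₐ[R] B) : SmashProduct α →ₗ[R] SmashProduct β :=
  LinearMap.rTensor H f.toLinearMap

theorem map_tmul {B : Type*} [Ring B] [Algebra R B] (β : ModuleAlgebraStr R H B) (f : A →ₐ[R] B)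
    (a : A) (h : H) : map α β f (tmul α a h) = tmul β (f a) h := rfl

end SmashProduct

/-- `β` extends the `H`-action `α` on `A` to the maximal left ring of quotients of `A`: it makes
`Q_max(A)` a left `H`-module algebra and the canonical map `A → Q_max(A)` `H`-linear. -/
def ModuleAlgebraStr.ExtendsToQmax (α : ModuleAlgebraStr R H A)
    (β : ModuleAlgebraStr R H (Qmax A)) : Prop :=
  ∀ (h : H) (a : A), β.act h (Qmax.of A a) = Qmax.of A (α.act h a)

variable (R) in
/-- Left integrals: `h t = ε(h) t` for all `h`. -/
def IsLeftIntegral (t : H) : Prop := ∀ h : H, h * t = counit (R := R) h • t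

variable (R) in
/-- Right integrals: `t h = ε(h) t` for all `h`. -/
def IsRightIntegral (t : H) : Prop := ∀ h : H, t * h = counit (R := R) h • t

end Hopf

/-! Write `Q = Qmax A`, `B = A # H`, `P = Q # H`. The plan is to show that `P` is an injective hull
of the left `B`-module `B` and that a `B`-endomorphism of `P` vanishing on `B` is zero;
`Qmax.exists_ringEquiv` then identifies `P` with `Qmax B`.

Since `A` is non-singular, `Q` is the injective hull of `A` as an `A`-module; it is injective and
non-singular over `A`, and each of its elements is carried into `A` by an essential left ideal. As
`H` is finitely generated projective, `P` is an `A`-summand of some `Q^n`, so it inherits these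
properties, with `B` in place of `A` as the target. Essentiality and density of `B` in `P` follow.

The passage from `A` to `B` is a Maschke argument. For a right integral `t`, the average `m ↦ ε(t)⁻¹
∑ S(t₁) f(t₂ m)` of an `A`-linear `f` is `B`-linear (`exists_normalized_average`); a left integral
is replaced by its antipode. Averaging an `A`-linear extension shows that `P` is `B`-injective. If
`b` has an essential left annihilator, right multiplication by `b` on `P` has a `B`-essential
kernel; that kernel is an `A`-summand, by averaging a `B`-summand, hence all of `P`, so `b = 0`. -/

section EssentialSubmodules

universe u v

/-! ### Essential submodules. -/

namespace IsEssentialSubmodule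

variable {S M M' : Type*} [Ring S] [AddCommGroup M] [Module S M] [AddCommGroup M'] [Module S M']

theorem iff_exists_smul {N : Submodule S M} :
    IsEssentialSubmodule N ↔ ∀ x : M, x ≠ 0 → ∃ a : S, a • x ∈ N ∧ a • x ≠ 0 := by
  constructor
  · intro h x hx
    by_contra! hc
    refine hx ?_
    have : Submodule.span S {x} = ⊥ := h _ (by
      rw [eq_bot_iff]
      rintro y ⟨hyN, hy⟩
      obtain ⟨a, rfl⟩ := Submodule.mem_span_singleton.1 hy
      exact hc a hyN)
    simpa using this
  · intro h L hL
    rw [eq_bot_iff]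
    intro x hx
    by_contra hx0
    obtain ⟨a, ha, ha0⟩ := h x hx0
    have : a • x ∈ N ⊓ L := ⟨ha, L.smul_mem a hx⟩
    rw [hL] at this
    exact ha0 this

theorem mono {N N' : Submodule S M} (h : IsEssentialSubmodule N) (hle : N ≤ N') :
    IsEssentialSubmodule N' := fun L hL =>
  h L (eq_bot_iff.2 (hL ▸ inf_le_inf_right L hle))

theorem inf {N N' : Submodule S M} (h : IsEssentialSubmodule N) (h' : IsEssentialSubmodule N') :
    IsEssentialSubmodule (N ⊓ N') := fun L hL =>
  h' L (h _ (by rw [← inf_assoc, hL]))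

theorem top : IsEssentialSubmodule (⊤ : Submodule S M) := fun L hL => by
  rwa [top_inf_eq] at hL

/-- Used mostly with `f = (· • x)` on `S`: the left ideal `{a | a • x ∈ N}` is essential. -/
theorem comap {N : Submodule S M} (h : IsEssentialSubmodule N) (f : M' →ₗ[S] M) :
    IsEssentialSubmodule (N.comap f) := by
  rw [iff_exists_smul]
  intro x hx
  by_cases hfx : f x = 0
  · exact ⟨1, by simp [hfx], by simpa using hx⟩
  · obtain ⟨a, ha, ha0⟩ := iff_exists_smul.1 h _ hfx
    refine ⟨a, by simpa using ha, fun h0 => ha0 ?_⟩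
    rw [← map_smul, h0, map_zero]

/-- Every submodule has a complement up to essentiality. -/
theorem exists_inf_eq_bot (K : Submodule S M) :
    ∃ C : Submodule S M, K ⊓ C = ⊥ ∧ IsEssentialSubmodule (K ⊔ C) := by
  obtain ⟨C, -, hC⟩ := zorn_le_nonempty₀ {C : Submodule S M | K ⊓ C = ⊥} (by
    intro c hc hchain y hy
    refine ⟨sSup c, ?_, fun z hz => le_sSup hz⟩
    change K ⊓ sSup c = ⊥
    rw [eq_bot_iff]
    rintro x ⟨hxK, hx⟩
    obtain ⟨z, hz, hxz⟩ := (Submodule.mem_sSup_of_directed ⟨y, hy⟩ hchain.directedOn).1 hx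
    have h1 : K ⊓ z = ⊥ := hc hz
    rw [← h1]
    exact ⟨hxK, hxz⟩) ⊥ (by simp)
  have hKC : K ⊓ C = ⊥ := hC.prop
  refine ⟨C, hKC, fun L hL => ?_⟩
  -- If `L` meets `K ⊔ C` trivially, then `C ⊔ L` still meets `K` trivially, so maximality of `C`
  -- absorbs `L`.
  have hCL : C ⊔ L ≤ C := hC.le_of_ge (by
    change K ⊓ (C ⊔ L) = ⊥
    rw [eq_bot_iff]
    rintro x ⟨hxK, hx⟩
    obtain ⟨c, hc, l, hl, rfl⟩ := Submodule.mem_sup.1 hx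
    have h1 : l ∈ (K ⊔ C) ⊓ L := by
      refine ⟨?_, hl⟩
      have := Submodule.sub_mem _ (Submodule.mem_sup_left hxK : _ ∈ K ⊔ C)
        (Submodule.mem_sup_right hc)
      simpa using this
    rw [hL, Submodule.mem_bot] at h1
    subst h1
    rw [← hKC]
    exact ⟨hxK, by simpa using hc⟩) le_sup_left
  rw [eq_bot_iff, ← hL]
  exact le_inf ((le_sup_right.trans hCL).trans le_sup_right) le_rfl

end IsEssentialSubmodule

/-! ### Non-singular modules and injective hulls. -/

/-- A module is non-singular if `0` is its only element with an essential annihilator. -/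
def IsNonsingularModule (S : Type u) (M : Type v) [Ring S] [AddCommGroup M] [Module S M] : Prop :=
  ∀ x : M, IsEssentialSubmodule (LinearMap.ker (LinearMap.toSpanSingleton S M x)) → x = 0

namespace IsNonsingularModule

variable {S M M' : Type*} [Ring S] [AddCommGroup M] [Module S M] [AddCommGroup M'] [Module S M']

theorem eq_zero (h : IsNonsingularModule S M) {N : Submodule S S} (hN : IsEssentialSubmodule N)
    {x : M} (hx : ∀ a ∈ N, a • x = 0) : x = 0 :=
  h x (hN.mono fun a ha => by simpa using hx a ha)

/-- Each `f x` is killed by the essential left ideal `{a | a • x ∈ N}`. -/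
theorem linearMap_eq_zero (h : IsNonsingularModule S M) {N : Submodule S M'}
    (hN : IsEssentialSubmodule N) (f : M' →ₗ[S] M) (hf : ∀ x ∈ N, f x = 0) : f = 0 := by
  ext x
  refine h.eq_zero (hN.comap (LinearMap.toSpanSingleton S M' x)) fun a ha => ?_
  rw [← map_smul]
  exact hf _ (by simpa using ha)

theorem of_injective (h : IsNonsingularModule S M) (f : M' →ₗ[S] M) (hf : Function.Injective f) :
    IsNonsingularModule S M' := fun x hx =>
  hf (by
    rw [map_zero]
    refine h.eq_zero hx fun a ha => ?_
    rw [← map_smul, show a • x = 0 by simpa using ha, map_zero])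

/-- A non-zero `x` has a non-zero multiple `a • x = f m`, and `m` is killed by `{b | b * a ∈ ann
x}`, which is essential when `ann x` is. -/
theorem of_essential (h : IsNonsingularModule S M') (f : M' →ₗ[S] M) (hf : Function.Injective f)
    (hess : IsEssentialSubmodule (LinearMap.range f)) : IsNonsingularModule S M := by
  intro x hx
  by_contra hx0
  obtain ⟨a, ⟨m, hm⟩, ha0⟩ := IsEssentialSubmodule.iff_exists_smul.1 hess x hx0
  refine ha0 ?_
  rw [← hm, h.eq_zero (hx.comap (LinearMap.toSpanSingleton S S a)) (x := m), map_zero]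
  intro b hb
  apply hf
  rw [map_smul, hm, map_zero, smul_smul]
  simpa using hb

end IsNonsingularModule

theorem isLeftNonsingular_iff {S : Type u} [Ring S] :
    IsLeftNonsingular S ↔ IsNonsingularModule S S := Iff.rfl

/-- In an injective module, a kernel of a homomorphism to a non-singular module has a
retraction. -/
theorem exists_retraction_ker {S M M' : Type*} [Ring S] [AddCommGroup M] [Module S M]
    [AddCommGroup M'] [Module S M'] (hM : Module.Baer S M) (hM' : IsNonsingularModule S M')
    (g : M →ₗ[S] M') :
    ∃ r : M →ₗ[S] M, (∀ x, g (r x) = 0) ∧ ∀ x, g x = 0 → r x = x := by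
  obtain ⟨C, hKC, hess⟩ := IsEssentialSubmodule.exists_inf_eq_bot (LinearMap.ker g)
  let i : (LinearMap.ker g × C) →ₗ[S] M := (LinearMap.ker g).subtype.coprod C.subtype
  have hi : Function.Injective i := by
    rw [injective_iff_map_eq_zero]
    rintro ⟨x, y⟩ hxy
    have hxy' : (x : M) + y = 0 := hxy
    have hy : (y : M) ∈ LinearMap.ker g ⊓ C := by
      refine ⟨?_, y.2⟩
      rw [eq_neg_of_add_eq_zero_right hxy']
      exact neg_mem x.2
    rw [hKC, Submodule.mem_bot] at hy
    rw [hy, add_zero] at hxy'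
    ext <;> assumption
  obtain ⟨r, hr⟩ := Module.Baer.extension_property hM i hi
    ((LinearMap.ker g).subtype ∘ₗ LinearMap.fst S _ _)
  have hr' : ∀ x (hx : x ∈ LinearMap.ker g) (y : M) (hy : y ∈ C), r (x + y) = x := fun x hx y hy =>
    LinearMap.congr_fun hr (⟨x, hx⟩, ⟨y, hy⟩)
  refine ⟨r, fun x => ?_, fun x hx => by simpa using hr' x hx 0 C.zero_mem⟩
  -- `r` extends the projection of `ker g ⊕ C` onto `ker g`. So `g ∘ r` vanishes on an essential
  -- submodule, and non-singularity forces all values of `r` into `ker g`.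
  refine LinearMap.congr_fun (hM'.linearMap_eq_zero hess (g ∘ₗ r) fun z hz => ?_) x
  obtain ⟨x, hx, y, hy, rfl⟩ := Submodule.mem_sup.1 hz
  rw [LinearMap.comp_apply, hr' x hx y hy]
  exact hx

/-- Injective hulls are unique. -/
theorem IsInjectiveHull.exists_equiv {S : Type u} {M E E' : Type v} [Ring S] [AddCommGroup M]
    [Module S M] [AddCommGroup E] [Module S E] [AddCommGroup E'] [Module S E'] {f : M →ₗ[S] E}
    {f' : M →ₗ[S] E'} (h : IsInjectiveHull f) (h' : IsInjectiveHull f') :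
    ∃ g : E ≃ₗ[S] E', ∀ x, g (f x) = f' x := by
  have aux : ∀ {F F' : Type v} [AddCommGroup F] [Module S F] [AddCommGroup F'] [Module S F']
      (k : M →ₗ[S] F) (k' : M →ₗ[S] F'), IsEssentialSubmodule (LinearMap.range k) →
      Function.Injective k' → ∀ g : F →ₗ[S] F', (∀ x, g (k x) = k' x) → Function.Injective g := by
    intro F F' _ _ _ _ k k' hk hk' g hg
    rw [← LinearMap.ker_eq_bot]
    refine hk _ (eq_bot_iff.2 ?_)
    rintro _ ⟨⟨x, rfl⟩, hx⟩
    have hx : g (k x) = 0 := hx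
    rw [hg, ← map_zero k'] at hx
    rw [hk' hx, map_zero]
    exact Submodule.zero_mem _
  obtain ⟨g, hg⟩ := h'.moduleInjective.out f h.injective f'
  have hginj := aux f f' h.essential h'.injective g hg
  obtain ⟨r, hr⟩ := h.moduleInjective.out g hginj LinearMap.id
  -- The left inverse `r` of `g` is injective for the same reason as `g`, so `g` is onto.
  have hrinj := aux f' f h'.essential h.injective r fun x => by rw [← hg, hr]; rfl
  exact ⟨LinearEquiv.ofBijective g ⟨hginj, fun y => ⟨r y, hrinj (hr _)⟩⟩, hg⟩

/-! ### Maximal rings of quotients. -/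

namespace Qmax

/-- A ring extension `S → P` which is an injective hull of the left `S`-module `S`, and in which
`S` is dense, is the maximal left ring of quotients of `S`. -/
theorem exists_ringEquiv {S P : Type u} [Ring S] [Ring P] [Module S P] (j : S →+* P)
    (hj : ∀ s p, s • p = j s * p) (jl : S →ₗ[S] P) (hull : IsInjectiveHull jl)
    (hdense : ∀ f : P →ₗ[S] P, (∀ s, f (j s) = 0) → f = 0) :
    ∃ e : Qmax S ≃+* P, ∀ s, e (of S s) = j s := by
  obtain ⟨g, -⟩ := (InjHull.isInjectiveHull S).exists_equiv hull
  let ρ : P → (P →ₗ[S] P) := fun p =>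
    { toFun := fun x => x * p
      map_add' := fun x y => add_mul x y p
      map_smul' := fun s x => by simp only [hj, RingHom.id_apply, mul_assoc] }
  -- By density, the `S`-endomorphisms of `P` are exactly the right multiplications, so its
  -- biendomorphisms are the left multiplications.
  have hρ : ∀ (f : P →ₗ[S] P) (p : P), f p = p * f 1 := fun f p => by
    have := hdense (f - ρ (f 1)) fun s => by
      have h1 : f (j s) = j s * f 1 := by rw [← hj, ← map_smul, hj, mul_one]
      simp [ρ, h1]
    exact sub_eq_zero.1 (LinearMap.congr_fun this p)
  let conj : (P →ₗ[S] P) → Module.End S (InjHull S) := fun f =>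
    g.symm.toLinearMap ∘ₗ f ∘ₗ g.toLinearMap
  have key : ∀ (φ : Qmax S) (p : P), g (φ (g.symm p)) = g (φ (g.symm 1)) * p := by
    intro φ p
    have h1 := φ.map_smul (conj (ρ p)) (g.symm 1)
    have h2 : conj (ρ p) • g.symm 1 = g.symm p := by simp [conj, ρ, Module.End.smul_def]
    rw [h2] at h1
    rw [h1]
    simp [conj, ρ, Module.End.smul_def]
  let e : Qmax S →+* P :=
    { toFun := fun φ => g (φ (g.symm 1))
      map_one' := by simp
      map_zero' := by simp
      map_add' := fun φ ψ => by simp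
      map_mul' := fun φ ψ => by
        rw [← key φ, LinearEquiv.symm_apply_apply, Module.End.mul_apply] }
  have he : Function.Bijective e := by
    constructor
    · intro φ ψ h
      ext x
      have h1 := key φ (g x)
      have h2 := key ψ (g x)
      rw [LinearEquiv.symm_apply_apply] at h1 h2
      refine g.injective ?_
      rw [h1, h2]
      exact congrArg (· * g x) h
    · intro p
      refine ⟨{ toFun := fun x => g.symm (p * g x)
                map_add' := fun x y => by simp [mul_add]
                map_smul' := fun l x => ?_ }, ?_⟩
      · have h1 : ∀ y, g (l y) = g y * g (l (g.symm 1)) := fun y => by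
          simpa using hρ (g.toLinearMap ∘ₗ l ∘ₗ g.symm.toLinearMap) (g y)
        refine g.injective ?_
        rw [RingHom.id_apply, Module.End.smul_def, Module.End.smul_def,
          LinearEquiv.apply_symm_apply,
          h1 x, h1 (g.symm (p * g x)), LinearEquiv.apply_symm_apply, mul_assoc]
      · change g (g.symm (p * g (g.symm 1))) = p
        simp
  refine ⟨RingEquiv.ofBijective e he, fun s => ?_⟩
  change g (s • g.symm 1) = j s
  rw [map_smul, hj, LinearEquiv.apply_symm_apply, mul_one]

variable (A : Type u) [Ring A]

theorem smul_def (a : A) (q : Qmax A) : a • q = of A a * q := rfl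

variable {A}

/-- For a left non-singular ring `A`, the left `A`-module `Q_max(A)` is isomorphic to the
injective hull of `A`. -/
theorem exists_linearEquiv (hA : IsLeftNonsingular A) :
    ∃ g : Qmax A ≃ₗ[A] InjHull A, ∀ a, g (of A a) = InjHull.of A a := by
  have hull := InjHull.isInjectiveHull A
  have hE : IsNonsingularModule A (InjHull A) :=
    IsNonsingularModule.of_essential (isLeftNonsingular_iff.1 hA) _ hull.injective hull.essential
  -- Non-singularity gives uniqueness and injectivity gives existence of an endomorphism of the hull
  -- with prescribed value at `1`.
  have huniq : ∀ l l' : Module.End A (InjHull A), l (InjHull.of A 1) = l' (InjHull.of A 1) →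
      l = l' := by
    intro l l' h
    rw [← sub_eq_zero]
    refine hE.linearMap_eq_zero hull.essential _ ?_
    rintro _ ⟨a, rfl⟩
    have h1 : InjHull.of A a = a • InjHull.of A 1 := by rw [← map_smul, smul_eq_mul, mul_one]
    rw [h1, map_smul, LinearMap.sub_apply, h, sub_self, smul_zero]
  have hex : ∀ x : InjHull A, ∃ l : Module.End A (InjHull A), l (InjHull.of A 1) = x := by
    intro x
    obtain ⟨l, hl⟩ := hull.moduleInjective.out _ hull.injective
      (LinearMap.toSpanSingleton A (InjHull A) x)
    exact ⟨l, by rw [hl]; simp⟩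
  choose l hl using hex
  let ev : Qmax A →ₗ[A] InjHull A :=
    { toFun := fun q => q (InjHull.of A 1)
      map_add' := fun _ _ => rfl
      map_smul' := fun _ _ => rfl }
  refine ⟨LinearEquiv.ofBijective ev ⟨fun q q' h => ?_, fun x => ?_⟩, fun a => ?_⟩
  · ext x
    have h1 := q.map_smul (l x) (InjHull.of A 1)
    have h2 := q'.map_smul (l x) (InjHull.of A 1)
    rw [Module.End.smul_def, hl] at h1 h2
    rw [h1, h2]
    exact congrArg (l x • ·) h
  -- Since `y = l y 1`, a biendomorphism with value `x` at `1` must send `y` to `l y x`. Uniqueness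
  -- of `l y` makes this formula linear over the endomorphism ring.
  · refine ⟨{ toFun := fun y => l y x
              map_add' := fun y y' => ?_
              map_smul' := fun k y => ?_ }, ?_⟩
    · rw [huniq (l (y + y')) (l y + l y') (by simp [hl])]
      rfl
    · rw [huniq (l (k • y)) (k * l y) (by simp [hl, Module.End.mul_apply])]
      rfl
    · change l (InjHull.of A 1) x = x
      rw [huniq (l (InjHull.of A 1)) 1 (by simp [hl])]
      rfl
  · change a • InjHull.of A 1 = InjHull.of A a
    rw [← map_smul, smul_eq_mul, mul_one]

theorem of_injective : Function.Injective (of A) := by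
  have hull := InjHull.isInjectiveHull A
  intro a b h
  refine hull.injective ?_
  have h1 : ∀ a, InjHull.of A a = of A a (InjHull.of A 1) := fun a => by
    change _ = a • InjHull.of A 1
    rw [← map_smul, smul_eq_mul, mul_one]
  rw [h1, h1 b, h]

theorem baer (hA : IsLeftNonsingular A) : Module.Baer A (Qmax A) := by
  obtain ⟨g, -⟩ := exists_linearEquiv hA
  exact Module.Baer.of_equiv g.symm
    (Module.Baer.of_injective (InjHull.isInjectiveHull A).moduleInjective)

theorem isNonsingularModule (hA : IsLeftNonsingular A) : IsNonsingularModule A (Qmax A) := by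
  obtain ⟨g, -⟩ := exists_linearEquiv hA
  have hull := InjHull.isInjectiveHull A
  exact IsNonsingularModule.of_injective
    (IsNonsingularModule.of_essential (isLeftNonsingular_iff.1 hA) _ hull.injective hull.essential)
    g.toLinearMap g.injective

/-- Elements of `Q_max(A)` are carried into `A` by essential left ideals. -/
theorem exists_essential (hA : IsLeftNonsingular A) (q : Qmax A) :
    ∃ N : Submodule A A, IsEssentialSubmodule N ∧ ∀ a ∈ N, ∃ b, of A a * q = of A b := by
  obtain ⟨g, hg⟩ := exists_linearEquiv hA
  refine ⟨_, (InjHull.isInjectiveHull A).essential.comap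
    (LinearMap.toSpanSingleton A _ (g q)), fun a ha => ?_⟩
  obtain ⟨b, hb⟩ := ha
  refine ⟨b, g.injective ?_⟩
  rw [hg, hb, ← smul_def, map_smul]
  simp

end Qmax

end EssentialSubmodules

section Hopf

open Coalgebra HopfAlgebra

universe u v w

/-! ### The antipode and integrals. -/

section Antipode

variable {R : Type u} {H : Type v} [CommRing R] [Ring H] [HopfAlgebra R H]

open WithConv in
/-- The antipode of a finitely generated projective Hopf algebra is surjective: it is the
convolution inverse of the identity, which is integral. -/
theorem antipode_surjective [Module.Finite R H] [Module.Projective R H] :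
    Function.Surjective (antipode R (A := H)) := by
  let T : Submodule R H := LinearMap.range (antipode R (A := H))
  have hT : ∀ n : ℕ, ∀ h, ((toConv (antipode R (A := H))) ^ n : WithConv (H →ₗ[R] H)) h ∈ T := by
    intro n
    induction n with
    | zero =>
      intro h
      rw [pow_zero, LinearMap.convOne_apply, Algebra.algebraMap_eq_smul_one]
      exact T.smul_mem _ ⟨1, antipode_one⟩
    | succ n ih =>
      intro h
      rw [pow_succ, (ℛ R h).convMul_apply]
      refine T.sum_mem fun i _ => ?_
      obtain ⟨x, hx⟩ := ih ((ℛ R h).left i)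
      rw [← hx]
      exact ⟨(ℛ R h).right i * x, antipode_mul_antidistrib _ _⟩
  -- `H` is a retract of `R^n`, so restriction along `g : H → R^n` maps `Hom(R^n, H) ≅ H^n` onto
  -- `Hom(H, H)`.
  have : Module.Finite R (H →ₗ[R] H) := by
    obtain ⟨n, f, g, -, -, hfg⟩ := Module.Finite.exists_comp_eq_id_of_projective R H
    refine Module.Finite.of_surjective
      (LinearMap.lcomp R H g ∘ₗ ((Pi.basisFun R (Fin n)).constr R (M' := H)).toLinearMap)
      fun u => ⟨((Pi.basisFun R (Fin n)).constr R).symm (u ∘ₗ f), ?_⟩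
    rw [LinearMap.comp_apply, LinearEquiv.coe_coe, LinearEquiv.apply_symm_apply]
    exact LinearMap.ext fun x => congrArg u (LinearMap.congr_fun hfg x)
  have : Module.Finite R (WithConv (H →ₗ[R] H)) :=
    Module.Finite.equiv (WithConv.linearEquiv R (H →ₗ[R] H)).symm
  obtain ⟨p, hp, hp0⟩ := IsIntegral.of_finite R (toConv (LinearMap.id : H →ₗ[R] H))
  set I := toConv (LinearMap.id : H →ₗ[R] H)
  set s := toConv (antipode R (A := H))
  have hIs : I * s = 1 := LinearMap.id_mul_antipode
  have hpow : ∀ k m : ℕ, I ^ k * s ^ (k + m) = s ^ m := by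
    intro k
    induction k with
    | zero => simp
    | succ k ih =>
      intro m
      rw [pow_succ, show k + 1 + m = (k + m) + 1 by ring, pow_succ', mul_assoc,
        ← mul_assoc I, hIs, one_mul, ih]
  have hI : I ^ p.natDegree = -∑ i ∈ Finset.range p.natDegree, p.coeff i • I ^ i := by
    have h1 : Polynomial.aeval I p = 0 := hp0
    rw [hp.as_sum] at h1
    simp only [map_add, map_sum, map_mul, map_pow, Polynomial.aeval_X, Polynomial.aeval_C,
      ← Algebra.smul_def] at h1
    exact eq_neg_of_add_eq_zero_left h1
  -- Multiply the integral equation of degree `n` by `I` on the left and by `s ^ n` on the right; `I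
  -- * s = 1` cancels everything but one `I` on one side and leaves powers of `s` on the other.
  have hI' : I = -∑ i ∈ Finset.range p.natDegree, p.coeff i • s ^ (p.natDegree - (i + 1)) := by
    have h1 : I * I ^ p.natDegree * s ^ p.natDegree = I := by
      have h2 := hpow p.natDegree 0
      rw [add_zero, pow_zero] at h2
      rw [mul_assoc, h2, mul_one]
    rw [hI] at h1
    rw [← h1, mul_neg, neg_mul, Finset.mul_sum, Finset.sum_mul, neg_inj]
    refine Finset.sum_congr rfl fun i hi => ?_
    rw [mul_smul_comm, smul_mul_assoc, ← pow_succ']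
    have hin : p.natDegree = i + 1 + (p.natDegree - (i + 1)) := by
      have := Finset.mem_range.1 hi; omega
    have h2 := hpow (i + 1) (p.natDegree - (i + 1))
    rw [← hin] at h2
    rw [h2]
  intro h
  have h1 : h = I h := rfl
  change h ∈ T
  rw [h1, hI']
  simp only [WithConv.ofConv_neg, WithConv.ofConv_sum, LinearMap.neg_apply, LinearMap.sum_apply]
  refine T.neg_mem (T.sum_mem fun i _ => T.smul_mem _ (hT _ _))

/-- The antipode carries a left integral to a right integral. -/
theorem IsLeftIntegral.antipode [Module.Finite R H] [Module.Projective R H] {t : H}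
    (ht : IsLeftIntegral R t) : IsRightIntegral R (antipode R t) := by
  intro h
  obtain ⟨h, rfl⟩ := antipode_surjective (R := R) h
  rw [← antipode_mul_antidistrib, ht, map_smul, counit_antipode]

theorem sum_counit_right_smul {ι : Type*} {h : H} (r : Repr R h ι) :
    ∑ i ∈ r.index, counit (R := R) (r.right i) • r.left i = h := by
  have := congrArg (TensorProduct.lift (LinearMap.lsmul R H).flip) (sum_tmul_counit_eq (R := R) r)
  simpa only [map_sum, TensorProduct.lift.tmul, LinearMap.flip_apply, LinearMap.lsmul_apply,
    one_smul] using this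

/-- A right integral `t` satisfies `∑ S(t₁) ⊗ t₂ h = ∑ h S(t₁) ⊗ t₂`. -/
theorem IsRightIntegral.sum_antipode_tmul_mul {t : H} (ht : IsRightIntegral R t) {ι : Type*}
    (r : Repr R t ι) (h : H) :
    ∑ i ∈ r.index, antipode R (r.left i) ⊗ₜ[R] (r.right i * h) =
      ∑ i ∈ r.index, (h * antipode R (r.left i)) ⊗ₜ[R] r.right i := by
  let D : H →ₗ[R] H ⊗[R] H := (antipode R).rTensor H ∘ₗ comul
  have hDt : D t = ∑ i ∈ r.index, antipode R (r.left i) ⊗ₜ[R] r.right i := by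
    simp [D, ← r.eq]
  have hDmul : ∀ y : H, D (t * y) = ∑ i ∈ r.index, ∑ k ∈ (ℛ R y).index,
      (antipode R ((ℛ R y).left k) * antipode R (r.left i)) ⊗ₜ[R]
        (r.right i * (ℛ R y).right k) := by
    intro y
    simp only [D, LinearMap.comp_apply, Bialgebra.comul_mul]
    rw [← r.eq, ← (ℛ R y).eq, Finset.sum_mul_sum]
    simp [antipode_mul_antidistrib]
  have hleft : ∀ (x : H), (LinearMap.mulLeft R x).rTensor H (D t) =
      ∑ i ∈ r.index, (x * antipode R (r.left i)) ⊗ₜ[R] r.right i := by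
    intro x
    simp [hDt]
  let ρ := ℛ R h
  -- The sum `∑ (h₁ ⊗ 1) D(t h₂)` is computed twice: by `t h₂ = ε(h₂) t` here, and below by
  -- expanding it to `∑ h₁ S(h₂) S(t₁) ⊗ t₂ h₃`, where `h₁ S(h₂)` collapses.
  have h1 : ∑ j ∈ ρ.index, (LinearMap.mulLeft R (ρ.left j)).rTensor H (D (t * ρ.right j)) =
      ∑ i ∈ r.index, (h * antipode R (r.left i)) ⊗ₜ[R] r.right i := by
    simp only [ht _, map_smul, hleft]
    rw [Finset.sum_congr rfl fun j _ => Finset.smul_sum, Finset.sum_comm]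
    refine Finset.sum_congr rfl fun i _ => ?_
    simp only [TensorProduct.smul_tmul', ← smul_mul_assoc, ← TensorProduct.sum_tmul,
      ← Finset.sum_mul]
    rw [sum_counit_right_smul ρ]
  rw [← h1]
  simp only [hDmul, map_sum, LinearMap.rTensor_tmul, LinearMap.mulLeft_apply]
  rw [Finset.sum_comm]
  refine Finset.sum_congr rfl fun i _ => ?_
  let G : H ⊗[R] (H ⊗[R] H) →ₗ[R] H ⊗[R] H :=
    TensorProduct.map (LinearMap.mulRight R (antipode R (r.left i)) ∘ₗ LinearMap.mul' R H ∘ₗ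
      (antipode R).lTensor H) (LinearMap.mulLeft R (r.right i)) ∘ₗ
    (TensorProduct.assoc R H H H).symm.toLinearMap
  have key := congrArg G (sum_tmul_tmul_eq ρ (fun i => ℛ R (ρ.left i)) (fun i => ℛ R (ρ.right i)))
  simp only [G, map_sum, LinearMap.comp_apply, LinearEquiv.coe_coe,
    TensorProduct.assoc_symm_tmul, TensorProduct.map_tmul, LinearMap.lTensor_tmul,
    LinearMap.mul'_apply, LinearMap.mulRight_apply, LinearMap.mulLeft_apply, ← TensorProduct.sum_tmul,
    ← Finset.sum_mul,
    sum_mul_antipode_eq_smul] at key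
  simp only [← mul_assoc, ← key]
  simp only [smul_mul_assoc, one_mul, TensorProduct.smul_tmul, ← TensorProduct.tmul_sum,
    ← mul_smul_comm, ← Finset.mul_sum, sum_counit_smul]

end Antipode

/-! ### Averaging over an integral. -/

section Average

variable {R : Type u} {H : Type v} {A : Type w} [CommRing R] [Ring H] [HopfAlgebra R H]
  [Ring A] [Algebra R A]

namespace SmashProduct

variable (α : ModuleAlgebraStr R H A)

noncomputable instance : Algebra R (SmashProduct α) :=
  Algebra.ofModule (fun c x y => LinearMap.congr_fun (map_smul (mulAux α) c x) y)
    (fun c x y => map_smul (mulAux α x) c y)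

theorem tmul_mul_one_tmul (a : A) (h g : H) :
    tmul α a h * tmul α 1 g = tmul α a (h * g) := by
  rw [tmul_mul_tmul α (ℛ R h)]
  simp only [α.act_one, Algebra.algebraMap_eq_smul_one, mul_smul_comm, mul_one]
  change ∑ i ∈ _, (_ • a) ⊗ₜ[R] (_ * g) = a ⊗ₜ[R] (h * g)
  simp only [TensorProduct.smul_tmul, ← TensorProduct.tmul_sum, ← smul_mul_assoc,
    ← Finset.sum_mul, sum_counit_smul]

theorem tmul_one_mul_tmul (a b : A) (g : H) :
    tmul α a 1 * tmul α b g = tmul α (a * b) g := by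
  have h1 : tmul α a 1 * tmul α b g = mulAux α (a ⊗ₜ 1) (b ⊗ₜ g) := rfl
  rw [h1, mulAux_tmul, map_one, mul_one, leftAct_tmul]
  rfl

/-- The embedding `h ↦ 1 # h` of `H` into `A # H`. -/
noncomputable def inr : H →ₐ[R] SmashProduct α :=
  AlgHom.ofLinearMap (TensorProduct.mk R A H 1) rfl fun h g => (tmul_mul_one_tmul α 1 h g).symm

/-- The embedding `a ↦ a # 1` of `A` into `A # H`. -/
noncomputable def inl : A →ₐ[R] SmashProduct α :=
  AlgHom.ofLinearMap ((TensorProduct.mk R A H).flip 1) rfl fun a b =>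
    (tmul_one_mul_tmul α a b 1).symm

theorem inr_apply (h : H) : inr α h = tmul α 1 h := rfl

theorem inl_apply (a : A) : inl α a = tmul α a 1 := rfl

theorem inl_mul_inr (a : A) (h : H) : inl α a * inr α h = tmul α a h := by
  rw [inl_apply, inr_apply, tmul_one_mul_tmul, mul_one]

theorem inr_mul_inl {ι : Type*} {h : H} (r : Repr R h ι) (a : A) :
    inr α h * inl α a = ∑ i ∈ r.index, inl α (α.act (r.left i) a) * inr α (r.right i) := by
  rw [inr_apply, inl_apply, tmul_mul_tmul α r]
  simp only [inl_mul_inr, one_mul, mul_one]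

@[elab_as_elim]
theorem induction_on {p : SmashProduct α → Prop} (x : SmashProduct α)
    (mul : ∀ a h, p (inl α a * inr α h)) (add : ∀ x y, p x → p y → p (x + y)) : p x := by
  induction x using TensorProduct.induction_on with
  | zero =>
    have := mul 0 0
    rwa [map_zero, zero_mul] at this
  | tmul a h =>
    have := mul a h
    rwa [inl_mul_inr] at this
  | add x y hx hy => exact add x y hx hy

open WithConv in
/-- `∑ S(h₁) (h₂ · a) = a S(h)` in `A # H`. -/
theorem sum_inr_antipode_mul_inl {ι : Type*} {h : H} (r : Repr R h ι) (a : A) :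
    ∑ i ∈ r.index, inr α (antipode R (r.left i)) * inl α (α.act (r.right i) a) =
      inl α a * inr α (antipode R h) := by
  let U : WithConv (H →ₗ[R] SmashProduct α) := toConv (inr α).toLinearMap
  let V : WithConv (H →ₗ[R] SmashProduct α) := toConv ((inr α).toLinearMap ∘ₗ antipode R)
  let X : WithConv (H →ₗ[R] SmashProduct α) :=
    toConv ((inl α).toLinearMap ∘ₗ α.act.toLinearMap.flip a)
  have hU : ∀ h, U h = inr α h := fun _ => rfl
  have hV : ∀ h, V h = inr α (antipode R h) := fun _ => rfl
  have hX : ∀ h, X h = inl α (α.act h a) := fun _ => rfl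
  have hUV : U * V = 1 := by
    ext h
    rw [(ℛ R h).convMul_apply]
    simp only [hU, hV, ← map_mul, ← map_sum, sum_mul_antipode_eq_algebraMap_counit,
      AlgHom.commutes, LinearMap.convOne_apply]
  have hVXU : V * (X * U) =
      toConv (LinearMap.mulLeft R (inl α a) ∘ₗ Algebra.linearMap R _ ∘ₗ counit) := by
    ext h
    have h1 : ∀ h, (X * U) h = inr α h * inl α a := fun h => by
      rw [(ℛ R h).convMul_apply, inr_mul_inl α (ℛ R h)]
      rfl
    rw [(ℛ R h).convMul_apply]
    simp only [h1, hV, ← mul_assoc, ← map_mul, ← Finset.sum_mul, ← map_sum,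
      sum_antipode_mul_eq_algebraMap_counit]
    rw [AlgHom.commutes, Algebra.commutes]
    rfl
  -- `V * (X * U)` is `h ↦ ε(h) a`; convolving with `V` on the right removes `U` and yields `a
  -- S(h)`.
  have hVX : V * X = V * (X * U) * V := by
    rw [mul_assoc, mul_assoc, hUV, mul_one]
  have := congrArg (fun W : WithConv (H →ₗ[R] SmashProduct α) => W.ofConv h) hVX
  rw [hVXU] at this
  rw [r.convMul_apply, (ℛ R h).convMul_apply] at this
  simp only [hV, hX] at this
  rw [this]
  simp only [LinearMap.comp_apply, Algebra.linearMap_apply, LinearMap.mulLeft_apply, mul_assoc,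
    ← Finset.mul_sum, ← Algebra.smul_def, ← map_smul, ← map_sum, sum_counit_smul]

variable {M N : Type*} [AddCommGroup M] [AddCommGroup N] [Module R M] [Module R N]
  [Module (SmashProduct α) M] [Module (SmashProduct α) N] [IsScalarTower R (SmashProduct α) M]
  [IsScalarTower R (SmashProduct α) N]

/-- Averaging an `A`-linear map by a right integral `t` gives an `A # H`-linear map. -/
theorem exists_average {t : H} (ht : IsRightIntegral R t) {ι : Type*} (r : Repr R t ι)
    (f : M →ₗ[R] N) (hf : ∀ a m, f (inl α a • m) = inl α a • f m) :
    ∃ F : M →ₗ[SmashProduct α] N, ∀ m,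
      F m = ∑ i ∈ r.index, inr α (antipode R (r.left i)) • f (inr α (r.right i) • m) := by
  have hH : ∀ h m, ∑ i ∈ r.index, inr α (antipode R (r.left i)) •
      f (inr α (r.right i) • inr α h • m) = inr α h • ∑ i ∈ r.index,
        inr α (antipode R (r.left i)) • f (inr α (r.right i) • m) := by
    intro h m
    let K : H ⊗[R] H →ₗ[R] N := TensorProduct.lift (Algebra.lsmul R R N).toLinearMap ∘ₗ
      TensorProduct.map (inr α).toLinearMap
        (f ∘ₗ (Algebra.lsmul R R M).toLinearMap.flip m ∘ₗ (inr α).toLinearMap)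
    have hK : ∀ x y, K (x ⊗ₜ y) = inr α x • f (inr α y • m) := fun _ _ => rfl
    have key := congrArg K (ht.sum_antipode_tmul_mul r h)
    simp only [map_sum, hK, map_mul, mul_smul] at key
    rw [key, Finset.smul_sum]
  -- This half needs no integral: `t₂ a = ∑ (t₂ · a) t₃`, the factor `t₂ · a` passes through `f`,
  -- and `∑ S(t₁) (t₂ · a) = a S(t₁)` by `sum_inr_antipode_mul_inl`.
  have hA : ∀ a m, ∑ i ∈ r.index, inr α (antipode R (r.left i)) •
      f (inr α (r.right i) • inl α a • m) = inl α a • ∑ i ∈ r.index,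
        inr α (antipode R (r.left i)) • f (inr α (r.right i) • m) := by
    intro a m
    let K : H ⊗[R] (H ⊗[R] H) →ₗ[R] N := TensorProduct.lift (Algebra.lsmul R R N).toLinearMap ∘ₗ
      TensorProduct.map (LinearMap.mul' R _ ∘ₗ TensorProduct.map
        ((inr α).toLinearMap ∘ₗ antipode R) ((inl α).toLinearMap ∘ₗ α.act.toLinearMap.flip a))
        (f ∘ₗ (Algebra.lsmul R R M).toLinearMap.flip m ∘ₗ (inr α).toLinearMap) ∘ₗ
      (TensorProduct.assoc R H H H).symm.toLinearMap
    have hK : ∀ x y z, K (x ⊗ₜ (y ⊗ₜ z)) =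
        (inr α (antipode R x) * inl α (α.act y a)) • f (inr α z • m) := fun _ _ _ => rfl
    have key := congrArg K
      (sum_tmul_tmul_eq r (fun i => ℛ R (r.left i)) (fun i => ℛ R (r.right i)))
    simp only [map_sum, hK, ← Finset.sum_smul, sum_inr_antipode_mul_inl] at key
    simp only [mul_smul] at key
    simp only [Finset.smul_sum]
    rw [key]
    refine Finset.sum_congr rfl fun i _ => ?_
    rw [← mul_smul (inr α (r.right i)), inr_mul_inl α (ℛ R (r.right i)), Finset.sum_smul, map_sum,
      Finset.smul_sum]
    simp only [mul_smul, hf]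
  refine ⟨{ toFun := fun m => ∑ i ∈ r.index,
              inr α (antipode R (r.left i)) • f (inr α (r.right i) • m)
            map_add' := fun x y => by simp only [smul_add, map_add, Finset.sum_add_distrib]
            map_smul' := fun b m => ?_ }, fun _ => rfl⟩
  rw [RingHom.id_apply]
  induction b using SmashProduct.induction_on α with
  | mul a h => simp only [mul_smul, hA, hH]
  | add x y hx hy => simp only [add_smul, smul_add, map_add, Finset.sum_add_distrib, hx, hy]

section

variable {M N : Type*} [AddCommGroup M] [AddCommGroup N] [Module (SmashProduct α) M]
  [Module (SmashProduct α) N]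

/-- If `ε(t)` is invertible in `A` for a left or right integral `t`, then `A`-linear maps between
`A # H`-modules can be averaged to `A # H`-linear maps. -/
theorem exists_normalized_average [Module.Finite R H] [Module.Projective R H] {t : H}
    (ht : IsLeftIntegral R t ∨ IsRightIntegral R t)
    (hεt : IsUnit (algebraMap R A (counit (R := R) t)))
    (f : M →+ N) (hf : ∀ a m, f (inl α a • m) = inl α a • f m) :
    ∃ F : M →ₗ[SmashProduct α] N,
      (∀ m n, (∀ h, f (inr α h • m) = inr α h • n) → F m = n) ∧
      ∀ K : Submodule (SmashProduct α) N, (∀ m, f m ∈ K) → ∀ m, F m ∈ K := by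
  wlog hr : IsRightIntegral R t generalizing t
  · exact this (Or.inr (ht.resolve_right hr).antipode) (by rwa [counit_antipode])
      (ht.resolve_right hr).antipode
  let _ : Module R M := Module.compHom M (algebraMap R (SmashProduct α))
  let _ : Module R N := Module.compHom N (algebraMap R (SmashProduct α))
  have hRM : ∀ (c : R) (m : M), c • m = algebraMap R (SmashProduct α) c • m := fun _ _ => rfl
  have hRN : ∀ (c : R) (n : N), c • n = algebraMap R (SmashProduct α) c • n := fun _ _ => rfl
  have : IsScalarTower R (SmashProduct α) M :=
    ⟨fun c b m => by rw [hRM, Algebra.smul_def, mul_smul]⟩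
  have : IsScalarTower R (SmashProduct α) N :=
    ⟨fun c b n => by rw [hRN, Algebra.smul_def, mul_smul]⟩
  let fR : M →ₗ[R] N :=
    { f with
      map_smul' := fun c m => by
        change f (c • m) = c • f m
        rw [hRM, hRN, ← (inl α).commutes, hf] }
  obtain ⟨F, hF⟩ := exists_average α hr (ℛ R t) fR hf
  have hunit : IsUnit (algebraMap R (SmashProduct α) (counit (R := R) t)) := by
    rw [← (inl α).commutes]
    exact hεt.map (inl α)
  obtain ⟨w, hw⟩ := hunit
  -- The inverse of a central unit is central, so rescaling by it preserves linearity.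
  have hcomm : ∀ b : SmashProduct α, Commute (↑w⁻¹ : SmashProduct α) b := fun b =>
    Commute.units_inv_left (by rw [hw]; exact Algebra.commutes _ _)
  refine ⟨{ toFun := fun m => (↑w⁻¹ : SmashProduct α) • F m
            map_add' := fun x y => by rw [map_add, smul_add]
            map_smul' := fun b x => by
              rw [map_smul, smul_smul, (hcomm b).eq, mul_smul, RingHom.id_apply] },
    fun m n hmn => ?_, fun K hK m => K.smul_mem _ ?_⟩
  · change (↑w⁻¹ : SmashProduct α) • F m = n
    -- Where `f` already respects `H`, the average is `∑ S(t₁) t₂ n = ε(t) n`.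
    have h1 : F m = (w : SmashProduct α) • n := by
      rw [hF, hw, ← (inr α).commutes, ← sum_antipode_mul_eq_algebraMap_counit (ℛ R t), map_sum,
        Finset.sum_smul]
      refine Finset.sum_congr rfl fun i _ => ?_
      rw [map_mul, mul_smul, ← hmn]
      rfl
    rw [h1, smul_smul, Units.inv_mul, one_smul]
  · change F m ∈ K
    rw [hF]
    exact K.sum_mem fun i _ => K.smul_mem _ (hK _)

end

end SmashProduct

end Average

end Hopf

theorem IsEssentialSubmodule.finset_inf {S M ι : Type*} [Ring S] [AddCommGroup M] [Module S M]
    (s : Finset ι) (N : ι → Submodule S M) (h : ∀ i ∈ s, IsEssentialSubmodule (N i)) :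
    IsEssentialSubmodule (s.inf N) :=
  Finset.inf_induction .top (fun _ h₁ _ h₂ => h₁.inf h₂) h

/-! ### Transfer of properties from `Q` to `Q # H` over `A`. -/

section Hopf

open Coalgebra HopfAlgebra

universe u v w

variable {R : Type u} {H : Type v} {A : Type w} [CommRing R] [Ring H] [HopfAlgebra R H]
  [Ring A] [Algebra R A]

namespace SmashProduct

/-- A finite dual basis of `H` over `R` induces one of `A # H` over `A`. This reduces statements
about `Q # H` as an `A`-module to finitely many coordinates in `Q`. -/
theorem exists_coordinates [Module.Finite R H] [Module.Projective R H]
    (α : ModuleAlgebraStr R H A) :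
    ∃ (n : ℕ) (c : Fin n → SmashProduct α →ₗ[R] A) (e : Fin n → H),
      (∀ i a x, c i (inl α a * x) = a * c i x) ∧
      ∀ x, ∑ i, inl α (c i x) * inr α (e i) = x := by
  obtain ⟨n, f, g, -, -, hfg⟩ := Module.Finite.exists_comp_eq_id_of_projective R H
  let c : Fin n → SmashProduct α →ₗ[R] A := fun i =>
    (TensorProduct.rid R A).toLinearMap ∘ₗ (LinearMap.proj i ∘ₗ g).lTensor A
  have hc : ∀ i a h, c i (inl α a * inr α h) = g h i • a := fun i a h => by
    rw [inl_mul_inr]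
    change TensorProduct.rid R A (a ⊗ₜ[R] g h i) = _
    rw [TensorProduct.rid_tmul]
  refine ⟨n, c, fun i => f (Pi.single i 1), fun i a x => ?_, fun x => ?_⟩
  · induction x using SmashProduct.induction_on α with
    | mul b h => rw [← mul_assoc, ← map_mul, hc, hc, mul_smul_comm]
    | add x y hx hy => rw [mul_add, map_add, hx, hy, map_add, mul_add]
  · induction x using SmashProduct.induction_on α with
    | mul a h =>
      simp only [hc, map_smul, smul_mul_assoc, ← mul_smul_comm, ← Finset.mul_sum]
      simp only [← map_smul, ← map_sum, ← Pi.single_smul, smul_eq_mul, mul_one,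
        Finset.univ_sum_single]
      rw [← LinearMap.comp_apply, hfg, LinearMap.id_apply]
    | add x y hx hy =>
      simp only [map_add, add_mul, Finset.sum_add_distrib, hx, hy]

variable {Q : Type w} [Ring Q] [Algebra R Q] (α : ModuleAlgebraStr R H A)
  (β : ModuleAlgebraStr R H Q) (φ : A →ₐ[R] Q)

/-- The ring homomorphism `A # H → Q # H` induced by an `H`-linear homomorphism `A → Q`. -/
noncomputable def mapAlgHom (hφ : ∀ h a, β.act h (φ a) = φ (α.act h a)) :
    SmashProduct α →ₐ[R] SmashProduct β :=
  AlgHom.ofLinearMap (map α β φ) (by rw [one_def, one_def, map_tmul, map_one]) fun x y => by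
    induction x using SmashProduct.induction_on α with
    | add x₁ x₂ h₁ h₂ => rw [add_mul, map_add, h₁, h₂, map_add, add_mul]
    | mul a h =>
      induction y using SmashProduct.induction_on α with
      | add y₁ y₂ h₁ h₂ => rw [mul_add, map_add, h₁, h₂, map_add, mul_add]
      | mul b g =>
        rw [inl_mul_inr, inl_mul_inr, map_tmul, map_tmul, tmul_mul_tmul α (ℛ R h),
          tmul_mul_tmul β (ℛ R h), map_sum]
        simp only [map_tmul, map_mul, hφ]

theorem mapAlgHom_apply (hφ : ∀ h a, β.act h (φ a) = φ (α.act h a)) (x : SmashProduct α) :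
    mapAlgHom α β φ hφ x = map α β φ x := rfl

theorem mapAlgHom_inl (hφ : ∀ h a, β.act h (φ a) = φ (α.act h a)) (a : A) :
    mapAlgHom α β φ hφ (inl α a) = inl β (φ a) := rfl

theorem mapAlgHom_inr (hφ : ∀ h a, β.act h (φ a) = φ (α.act h a)) (h : H) :
    mapAlgHom α β φ hφ (inr α h) = inr β h := by
  rw [mapAlgHom_apply, inr_apply, map_tmul, map_one, inr_apply]

theorem mapAlgHom_injective [Module.Projective R H] (hφ : ∀ h a, β.act h (φ a) = φ (α.act h a))
    (hinj : Function.Injective φ) : Function.Injective (mapAlgHom α β φ hφ) :=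
  Module.Flat.rTensor_preserves_injective_linearMap (M := H) φ.toLinearMap hinj

section

variable {α β φ} [Module.Finite R H] [Module.Projective R H] [Module A Q]
  [Module A (SmashProduct β)]

/-- A map from a left ideal is extended coordinate by coordinate and reassembled with the dual
basis. -/
theorem baer
    (hQ : ∀ (a : A) (q : Q), a • q = φ a * q)
    (hAP : ∀ (a : A) (p : SmashProduct β), a • p = inl β (φ a) * p)
    (hB : Module.Baer A Q) : Module.Baer A (SmashProduct β) := by
  obtain ⟨n, c, e, hc, he⟩ := exists_coordinates β
  intro I g
  have hex : ∀ i, ∃ ψ : A →ₗ[A] Q, ∀ (x : A) (hx : x ∈ I), ψ x = c i (g ⟨x, hx⟩) := fun i =>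
    hB I { toFun := fun x => c i (g x)
           map_add' := fun x y => by rw [map_add, map_add]
           map_smul' := fun a x => by rw [map_smul, hAP, hc, RingHom.id_apply, hQ] }
  choose ψ hψ using hex
  refine ⟨{ toFun := fun a => ∑ i, inl β (ψ i a) * inr β (e i)
            map_add' := fun a b => by simp only [map_add, add_mul, Finset.sum_add_distrib]
            map_smul' := fun a b => ?_ }, fun x hx => ?_⟩
  · simp only [map_smul, hQ, map_mul, hAP, RingHom.id_apply, Finset.mul_sum, mul_assoc]
  · change ∑ i, inl β (ψ i x) * inr β (e i) = _
    simp only [hψ _ x hx, he]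

theorem isNonsingularModule
    (hQ : ∀ (a : A) (q : Q), a • q = φ a * q)
    (hAP : ∀ (a : A) (p : SmashProduct β), a • p = inl β (φ a) * p)
    (hN : IsNonsingularModule A Q) :
    IsNonsingularModule A (SmashProduct β) := by
  obtain ⟨n, c, e, hc, he⟩ := exists_coordinates β
  intro p hp
  rw [← he p]
  refine Finset.sum_eq_zero fun i _ => ?_
  rw [hN.eq_zero hp (x := c i p) fun a ha => ?_, map_zero, zero_mul]
  have ha : a • p = 0 := by simpa using ha
  rw [hQ, ← hc, ← hAP, ha, map_zero]

end

/-- The essential left ideals belonging to the finitely many coordinates of `p` are intersected. -/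
theorem exists_essential [Module.Finite R H] [Module.Projective R H]
    (hφ : ∀ h a, β.act h (φ a) = φ (α.act h a))
    (hess : ∀ q, ∃ N : Submodule A A, IsEssentialSubmodule N ∧ ∀ a ∈ N, ∃ b, φ a * q = φ b)
    (p : SmashProduct β) :
    ∃ N : Submodule A A, IsEssentialSubmodule N ∧
      ∀ a ∈ N, ∃ b, inl β (φ a) * p = mapAlgHom α β φ hφ b := by
  obtain ⟨n, c, e, hc, he⟩ := exists_coordinates β
  choose N hN hN' using fun i => hess (c i p)
  refine ⟨Finset.univ.inf N, .finset_inf _ _ fun i _ => hN i, fun a ha => ?_⟩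
  rw [Submodule.mem_finsetInf] at ha
  choose b hb using fun i => hN' i a (ha i (Finset.mem_univ i))
  refine ⟨∑ i, inl α (b i) * inr α (e i), ?_⟩
  rw [map_sum, ← he p, Finset.mul_sum]
  simp only [map_mul, mapAlgHom_inl, mapAlgHom_inr, ← mul_assoc, ← hb]

end SmashProduct

end Hopf

/-! ### From `A`-modules to `A # H`-modules. -/

section Hopf

open Coalgebra HopfAlgebra

universe u v w

variable {R : Type u} {H : Type v} {A : Type w} [CommRing R] [Ring H] [HopfAlgebra R H]
  [Ring A] [Algebra R A]

namespace SmashProduct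

variable {α : ModuleAlgebraStr R H A} [Module.Finite R H] [Module.Projective R H] {t : H}

/-- A module over `A # H` that is injective over `A` is injective. -/
theorem injective_of_baer (ht : IsLeftIntegral R t ∨ IsRightIntegral R t)
    (hεt : IsUnit (algebraMap R A (counit (R := R) t)))
    {P : Type*} [AddCommGroup P] [Module A P] [Module (SmashProduct α) P]
    (hAP : ∀ (a : A) (p : P), a • p = inl α a • p) (hP : Module.Baer A P) :
    Module.Injective (SmashProduct α) P := by
  refine ⟨fun X Y _ _ _ _ f hf g => ?_⟩
  let _ : Module A X := Module.compHom X (inl α).toRingHom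
  let _ : Module A Y := Module.compHom Y (inl α).toRingHom
  have hX : ∀ (a : A) (x : X), a • x = inl α a • x := fun _ _ => rfl
  have hY : ∀ (a : A) (y : Y), a • y = inl α a • y := fun _ _ => rfl
  let fA : X →ₗ[A] Y := { f with map_smul' := fun a x => f.map_smul (inl α a) x }
  let gA : X →ₗ[A] P :=
    { g with map_smul' := fun a x => by rw [RingHom.id_apply, hAP]; exact g.map_smul (inl α a) x }
  obtain ⟨k, hk⟩ := Module.Baer.extension_property hP fA hf gA
  have hk' : ∀ x, k (f x) = g x := fun x => LinearMap.congr_fun hk x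
  obtain ⟨F, hF, -⟩ := exists_normalized_average α ht hεt k.toAddMonoidHom fun a y => by
    change k (a • y) = inl α a • k y
    rw [map_smul, hAP]
  -- On the image of `f` the extension `k` agrees with the `A # H`-linear `g`, so averaging does not
  -- change it there.
  refine ⟨F, fun x => hF _ _ fun h => ?_⟩
  rw [← map_smul, ← map_smul]
  exact hk' _

/-- If a module over `A # H` is injective and non-singular over `A`, then its endomorphisms with
essential kernel are zero. -/
theorem eq_zero_of_essential_ker (ht : IsLeftIntegral R t ∨ IsRightIntegral R t)
    (hεt : IsUnit (algebraMap R A (counit (R := R) t)))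
    {P : Type*} [AddCommGroup P] [Module A P] [Module (SmashProduct α) P]
    (hAP : ∀ (a : A) (p : P), a • p = inl α a • p) (hP : Module.Baer A P)
    (hPn : IsNonsingularModule A P) (g : P →ₗ[SmashProduct α] P)
    (hg : IsEssentialSubmodule (LinearMap.ker g)) : g = 0 := by
  let gA : P →ₗ[A] P :=
    { g with
      map_smul' := fun a x => by
        rw [RingHom.id_apply, hAP, hAP]
        exact g.map_smul (inl α a) x }
  obtain ⟨r, hgr, hr⟩ := exists_retraction_ker hP hPn gA
  obtain ⟨F, hF, hFK⟩ := exists_normalized_average α ht hεt r.toAddMonoidHom fun a y => by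
    change r (inl α a • y) = inl α a • r y
    rw [← hAP, map_smul, hAP]
  have hgF : ∀ p, g (F p) = 0 := hFK (LinearMap.ker g) hgr
  have hFg : ∀ p, g p = 0 → F p = p := fun p hp => hF p p fun h => hr _ (by
    change g (inr α h • p) = 0
    rw [map_smul, hp, smul_zero])
  -- The kernel of `g` is essential only over `A # H`, so non-singularity over `A` does not apply
  -- directly. But `F` is an `A # H`-linear projection onto it, so `ker F` meets it trivially and
  -- vanishes; then `F` is the identity.
  have hker : LinearMap.ker F = ⊥ := hg _ (by
    rw [eq_bot_iff]
    rintro p ⟨hp, hp'⟩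
    have h1 := hFg p hp
    rw [LinearMap.mem_ker.1 hp'] at h1
    exact h1.symm)
  ext p
  have h1 : F p - p ∈ LinearMap.ker F := by
    rw [LinearMap.mem_ker, map_sub, hFg _ (hgF p), sub_self]
  rw [hker, Submodule.mem_bot, sub_eq_zero] at h1
  rw [← h1, hgF, LinearMap.zero_apply]

end SmashProduct

end Hopf

/-! ### The main theorem. -/

theorem mainTheorem8 {R : Type*} {H : Type*} {A : Type*} [CommRing R] [Ring H] [HopfAlgebra R H]
    [Module.Finite R H] [Module.Projective R H] [Ring A] [Algebra R A]
    (α : ModuleAlgebraStr R H A) (t : H) (ht : IsLeftIntegral R t ∨ IsRightIntegral R t)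
    (hεt : IsUnit (algebraMap R A (Coalgebra.counit (R := R) t)))
    (β : ModuleAlgebraStr R H (Qmax A)) (hβ : α.ExtendsToQmax β)
    (hA : IsLeftNonsingular A) :
    IsLeftNonsingular (SmashProduct α) ∧
      ∃ e : Qmax (SmashProduct α) ≃+* SmashProduct β,
        ∀ x : SmashProduct α,
          e (Qmax.of (SmashProduct α) x) = SmashProduct.map α β (Qmax.ofAlgHom R A) x := by
  let j := SmashProduct.mapAlgHom α β (Qmax.ofAlgHom R A) hβ
  have hj : Function.Injective j := SmashProduct.mapAlgHom_injective _ _ _ _ Qmax.of_injective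
  let _ : Module (SmashProduct α) (SmashProduct β) := Module.compHom _ j.toRingHom
  let _ : Module A (SmashProduct β) :=
    Module.compHom _ (j.comp (SmashProduct.inl α)).toRingHom
  have hBP : ∀ (b : SmashProduct α) (p : SmashProduct β), b • p = j b * p := fun _ _ => rfl
  have hAP : ∀ (a : A) (p : SmashProduct β), a • p = SmashProduct.inl α a • p := fun _ _ => rfl
  have hAP' : ∀ (a : A) (p : SmashProduct β),
      a • p = SmashProduct.inl β (Qmax.ofAlgHom R A a) * p := fun _ _ => rfl
  have hbaer : Module.Baer A (SmashProduct β) :=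
    SmashProduct.baer (φ := Qmax.ofAlgHom R A) (Qmax.smul_def A) hAP' (Qmax.baer hA)
  have hns : IsNonsingularModule A (SmashProduct β) :=
    SmashProduct.isNonsingularModule (φ := Qmax.ofAlgHom R A) (Qmax.smul_def A) hAP'
      (Qmax.isNonsingularModule hA)
  have hess := SmashProduct.exists_essential α β (Qmax.ofAlgHom R A) hβ
    (Qmax.exists_essential hA)
  let jl : SmashProduct α →ₗ[SmashProduct α] SmashProduct β :=
    { toFun := j
      map_add' := map_add j
      map_smul' := fun b x => map_mul j b x }
  have hjess : IsEssentialSubmodule (LinearMap.range jl) := by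
    rw [IsEssentialSubmodule.iff_exists_smul]
    intro p hp
    obtain ⟨N, hN, hNp⟩ := hess p
    by_contra! hc
    -- If all multiples of `p` lying in `A # H` were zero, the essential left ideal `N` of `A`
    -- carrying `p` into `A # H` would kill `p`.
    refine hp (hns.eq_zero hN fun a ha => hc (SmashProduct.inl α a) ?_)
    obtain ⟨b, hb⟩ := hNp a ha
    exact ⟨b, hb.symm⟩
  constructor
  · intro b hb
    let g : SmashProduct β →ₗ[SmashProduct α] SmashProduct β :=
      { toFun := fun p => p * j b
        map_add' := fun x y => add_mul x y _
        map_smul' := fun c p => mul_assoc (j c) p (j b) }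
    have hg : g = 0 := by
      refine SmashProduct.eq_zero_of_essential_ker ht hεt hAP hbaer hns g ?_
      -- A non-zero `p` is first multiplied by `c` into `A # H`, then by `d` into the left
      -- annihilator of `b`, staying non-zero.
      rw [IsEssentialSubmodule.iff_exists_smul] at hb hjess ⊢
      intro p hp
      obtain ⟨c, ⟨x, hx⟩, hc⟩ := hjess p hp
      have hx0 : x ≠ 0 := fun h => hc (by rw [← hx, h, map_zero])
      obtain ⟨d, hd, hd0⟩ := hb x hx0
      have hdx : (d * c) • p = j (d • x) := by
        rw [mul_smul, ← hx]
        exact (jl.map_smul d x).symm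
      refine ⟨d * c, ?_, fun h => hd0 (hj ?_)⟩
      · rw [hdx, LinearMap.mem_ker]
        change j (d • x) * j b = 0
        rw [← map_mul]
        have : (d • x) * b = 0 := hd
        rw [this, map_zero]
      · rw [← hdx, h, map_zero]
    refine hj ?_
    have h1 : g 1 = 0 := by rw [hg, LinearMap.zero_apply]
    rw [map_zero, ← h1]
    exact (one_mul _).symm
  · refine Qmax.exists_ringEquiv j.toRingHom hBP jl
      ⟨SmashProduct.injective_of_baer ht hεt hAP hbaer, hj, hjess⟩ fun f hf => ?_
    ext p
    obtain ⟨N, hN, hNp⟩ := hess p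
    -- Density: `N` carries `p` into `A # H`, where `f` vanishes, so `N` kills `f p`.
    refine hns.eq_zero hN fun a ha => ?_
    obtain ⟨b, hb⟩ := hNp a ha
    rw [hAP, ← map_smul, ← hAP, hAP', hb]
    exact hf b
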